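/- A \emph{parametrization} on a set $X$ is a map $U\to X$ with $U\subset\mathbb{R}^n$ open, for some $n\ge 0$. A \emph{diffeology} on $X$ is a set of parametrizations on $X$, called \emph{plots}, that contains all constant parametrizations, contains every parametrization that is locally a plot, and is closed under precomposition with $C^\infty$ maps between open subsets of Euclidean spaces. The diffeology \emph{generated} by a family $\mathcal F$ of parametrizations is the one whose plots are the parametrizations that, near each point of their domain, are either constant or of the form $p\circ f$ with $p\in\mathcal F$ and $f$ a $C^\infty$ map into the domain of $p$. The \emph{D-topology} of a diffeological space is the finest topology for which all plots are continuous. A quotient of a diffeological space carries the \emph{quotient diffeology}, whose plots are the parametrizations that locally lift to plots. A diffeological space $X$ is \emph{locally diffeomorphic} to a diffeological space $Y$ at $x\in X$ if there are a subset $A\ni x$ of $X$ and an injective map $f\colon A\to Y$ such that for every plot $p$ of $X$ the set $p^{-1}(A)$ is open and $f\circ p\colon p^{-1}(A)\to Y$ is a plot of $Y$, and for every plot $q$ of $Y$ the set $q^{-1}(f(A))$ is open and $f^{-1}\circ q\colon q^{-1}(f(A))\to X$ is a plot of $X$. A \emph{diffeological orbifold} is a diffeological space that is locally diffeomorphic at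 each of its points to a quotient $\mathbb{R}^n/\Gamma$, where $\Gamma$ is a finite group acting linearly on $\mathbb{R}^n$ ($n$ and $\Gamma$ may depend on the point). Let $Q$ be a topological space. A \emph{uniformizing chart} on $Q$ is a triple $(\tilde U,G,\pi)$ in which $\tilde U$ is an open ball in $\mathbb{R}^n$ for some $n\ge 0$ (depending on the chart), $G$ is a finite group of $C^\infty$ diffeomorphisms of $\tilde U$, and $\pi\colon\tilde U\to Q$ is a map that induces a homeomorphism of $\tilde U/G$ onto an open subset of $Q$. A collection $\{(\tilde U_i,G_i,\pi_i)\}$ of uniformizing charts satisfies \emph{Haefliger's compatibility condition} if, for all $i,j$ and all $\tilde u_i\in\tilde U_i$, $\tilde u_j\in\tilde U_j$ with $\pi_i(\tilde u_i)=\pi_j(\tilde u_j)$, there is a $C^\infty$ diffeomorphism $g$ from an open neighborhood of $\tilde u_i$ in $\tilde U_i$ onto an open neighborhood of $\tilde u_j$ in $\tilde U_j$ such that $\pi_j\circ g=\pi_i$ on a neighborhood of $\tilde u_i$. \textbf{Theorem.} (1) Let $\{(\tilde U_i,G_i,\pi_i)\}$ be a collection of uniformizing charts on a topological space $Q$ that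 satisfies Haefliger's compatibility condition and such that the sets $\pi_i(\tilde U_i)$ cover $Q$. Then $Q$, with the diffeology generated by the maps $\pi_i$, is a diffeological orbifold. (2) Two such collections on the same topological space $Q$ generate the same diffeology if and only if their union satisfies Haefliger's compatibility condition. (3) Every diffeological orbifold is obtained in this way: if $Q$ is a diffeological orbifold, then on $Q$ with its D-topology there is a collection of uniformizing charts that satisfies Haefliger's compatibility condition, covers $Q$, and generates the given diffeology of $Q$. -/

import Mathlib

open scoped ContDiff
open Diffeology

/-! ### Plots on open subsets, quotient diffeology, generated diffeology -/

/-- Plots of a diffeological space are recorded on the whole spaces `ℝⁿ` only.  A map `p : U → X`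
on a subset `U` of `ℝⁿ` is a plot if `U` is open and `p` turns every smooth map `ℝᵐ → U` into a
plot (by locality, applied to small balls, this determines the plots with open domains). -/
def IsPlotOn {X : Type*} [DiffeologicalSpace X] {n : ℕ} {U : Set (EuclideanSpace ℝ (Fin n))}
    (p : U → X) : Prop :=
  IsOpen U ∧ ∀ (m : ℕ) (f : EuclideanSpace ℝ (Fin m) → EuclideanSpace ℝ (Fin n)),
    ContDiff ℝ ∞ f → ∀ h : ∀ x, f x ∈ U, IsPlot fun x => p ⟨f x, h x⟩

/-- An open set of `ℝⁿ` contains around each of its points an open set `W` that is parametrized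
by the whole of `ℝⁿ`. -/
theorem exists_euclidean_reparam {n : ℕ} {u : Set (EuclideanSpace ℝ (Fin n))} (hu : IsOpen u)
    {x : EuclideanSpace ℝ (Fin n)} (hx : x ∈ u) :
    ∃ (e e' : EuclideanSpace ℝ (Fin n) → EuclideanSpace ℝ (Fin n))
      (W : Set (EuclideanSpace ℝ (Fin n))), IsOpen W ∧ x ∈ W ∧ ContDiff ℝ ∞ e ∧
        ContDiffOn ℝ ∞ e' W ∧ (∀ y, e y ∈ u) ∧ ∀ y ∈ W, e (e' y) = y := by
  obtain ⟨ε, hε, hεu⟩ := Metric.isOpen_iff.mp hu x hx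
  refine ⟨OpenPartialHomeomorph.univBall x ε, (OpenPartialHomeomorph.univBall x ε).symm,
    Metric.ball x ε, Metric.isOpen_ball, Metric.mem_ball_self hε,
    OpenPartialHomeomorph.contDiff_univBall, OpenPartialHomeomorph.contDiffOn_univBall_symm,
    fun y => hεu ?_, fun y hy => ?_⟩
  · have h := (OpenPartialHomeomorph.univBall x ε).map_source (x := y) (by simp)
    rwa [OpenPartialHomeomorph.univBall_target x hε] at h
  · exact (OpenPartialHomeomorph.univBall x ε).right_inv
      (by rwa [OpenPartialHomeomorph.univBall_target x hε])

/-- The quotient diffeology: the plots are the maps that locally lift to plots. -/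
instance quotientDiffeology {X : Type*} [DiffeologicalSpace X] (s : Setoid X) :
    DiffeologicalSpace (Quotient s) where
  plots n := {p | ∀ x : EuclideanSpace ℝ (Fin n), ∃ V : Set (EuclideanSpace ℝ (Fin n)),
    IsOpen V ∧ x ∈ V ∧ ∃ q : V → X, IsPlotOn q ∧ ∀ v : V, p v = Quotient.mk s (q v)}
  constant_plots {n} y x := by
    obtain ⟨y, rfl⟩ := Quotient.exists_rep y
    exact ⟨Set.univ, isOpen_univ, Set.mem_univ _, fun _ => y,
      ⟨isOpen_univ, fun _ _ _ _ => isPlot_const⟩, fun _ => rfl⟩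
  plot_reparam {n m p f} hp hf x := by
    obtain ⟨V, hV, hxV, q, hq, hpq⟩ := hp (f x)
    refine ⟨f ⁻¹' V, hV.preimage hf.continuous, hxV, fun v => q ⟨f v, v.2⟩,
      ⟨hV.preimage hf.continuous, fun k g hg h => ?_⟩, fun v => hpq ⟨f v, v.2⟩⟩
    exact hq.2 k (f ∘ g) (hf.comp hg) h
  locality {n p} hp x := by
    obtain ⟨u, hu, hxu, h⟩ := hp x
    obtain ⟨e, e', W, hW, hxW, he, he', heu, hee⟩ := exists_euclidean_reparam hu hxu
    obtain ⟨V, hV, hxV, q, hq, hpq⟩ := h heu he (e' x)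
    have hO : IsOpen (W ∩ e' ⁻¹' V) := he'.continuousOn.isOpen_inter_preimage hW hV
    refine ⟨W ∩ e' ⁻¹' V, hO, ⟨hxW, hxV⟩, fun v => q ⟨e' v, v.2.2⟩, ⟨hO, fun k g hg hgV => ?_⟩,
      fun v => ?_⟩
    · exact hq.2 k (e' ∘ g) (he'.comp_contDiff hg fun y => (hgV y).1) fun y => (hgV y).2
    · have := hpq ⟨e' v, v.2.2⟩
      simpa [hee v v.2.1] using this

/-- A parametrization on `X`: a map to `X` from an open subset of some `ℝⁿ`. -/
structure Parametrization (X : Type*) where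
  dim : ℕ
  dom : Set (EuclideanSpace ℝ (Fin dim))
  isOpen_dom : IsOpen dom
  toFun : dom → X

/-- The diffeology generated by a family of parametrizations: a map is a plot if locally it is
constant or factors smoothly through a member of the family. -/
@[reducible] def generatedDiffeology {X : Type*} (F : Set (Parametrization X)) : DiffeologicalSpace X where
  plots n := {q | ∀ x : EuclideanSpace ℝ (Fin n), ∃ W : Set (EuclideanSpace ℝ (Fin n)),
    IsOpen W ∧ x ∈ W ∧ ((∃ y : X, ∀ w ∈ W, q w = y) ∨
      ∃ p ∈ F, ∃ f : EuclideanSpace ℝ (Fin n) → EuclideanSpace ℝ (Fin p.dim),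
        ContDiffOn ℝ ∞ f W ∧ ∃ h : ∀ w ∈ W, f w ∈ p.dom,
          ∀ (w) (hw : w ∈ W), q w = p.toFun ⟨f w, h w hw⟩)}
  constant_plots {n} y x := ⟨Set.univ, isOpen_univ, Set.mem_univ _, Or.inl ⟨y, fun _ _ => rfl⟩⟩
  plot_reparam {n m q g} hq hg x := by
    obtain ⟨W, hW, hxW, h⟩ := hq (g x)
    refine ⟨g ⁻¹' W, hW.preimage hg.continuous, hxW, ?_⟩
    rcases h with ⟨y, hy⟩ | ⟨p, hp, f, hf, h, hqf⟩
    · exact Or.inl ⟨y, fun w hw => hy _ hw⟩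
    · exact Or.inr ⟨p, hp, f ∘ g, hf.comp hg.contDiffOn fun _ hw => hw, fun w hw => h _ hw,
        fun w hw => hqf _ hw⟩
  locality {n q} hq x := by
    obtain ⟨u, hu, hxu, h⟩ := hq x
    obtain ⟨e, e', V, hV, hxV, he, he', heu, hee⟩ := exists_euclidean_reparam hu hxu
    obtain ⟨W, hW, hxW, h⟩ := h heu he (e' x)
    refine ⟨V ∩ e' ⁻¹' W, he'.continuousOn.isOpen_inter_preimage hV hW, ⟨hxV, hxW⟩, ?_⟩
    rcases h with ⟨y, hy⟩ | ⟨p, hp, f, hf, h, hqf⟩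
    · refine Or.inl ⟨y, fun w hw => ?_⟩
      simpa [hee w hw.1] using hy _ hw.2
    · refine Or.inr ⟨p, hp, f ∘ e', hf.comp (he'.mono Set.inter_subset_left) fun _ hw => hw.2,
        fun w hw => h _ hw.2, fun w hw => ?_⟩
      have := hqf _ hw.2
      simpa [hee w hw.1] using this

/-! ### Diffeological orbifolds -/

/-- `X` is locally diffeomorphic to `Y` at `x`: there are a subset `A` of `X` containing `x` and
an injective map `f : A → Y` such that `f ∘ p` (with domain `p⁻¹(A)`) is a plot of `Y` for every
plot `p` of `X`, and `f⁻¹ ∘ q` (with domain `q⁻¹(f(A))`) is a plot of `X` for every plot `q`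
of `Y`. -/
def IsLocallyDiffeomorphicAt {X : Type*} [DiffeologicalSpace X] (x : X)
    (Y : Type*) [DiffeologicalSpace Y] : Prop :=
  ∃ A : Set X, x ∈ A ∧ ∃ (f : A → Y) (hf : Function.Injective f),
    (∀ (n : ℕ) (p : EuclideanSpace ℝ (Fin n) → X), IsPlot p →
      IsPlotOn fun u : p ⁻¹' A => f ⟨p u, u.2⟩) ∧
    (∀ (n : ℕ) (q : EuclideanSpace ℝ (Fin n) → Y), IsPlot q →
      IsPlotOn fun v : q ⁻¹' Set.range f => ((Equiv.ofInjective f hf).symm ⟨q v, v.2⟩ : X))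

/-- A diffeological orbifold: a diffeological space that is locally diffeomorphic at each point to
some `ℝⁿ/Γ`, with the quotient diffeology, where `Γ` is a finite group of linear automorphisms
of `ℝⁿ`; `n` and `Γ` may depend on the point. -/
def IsDiffeologicalOrbifold (X : Type*) [DiffeologicalSpace X] : Prop :=
  ∀ x : X, ∃ (n : ℕ)
    (Γ : Subgroup (EuclideanSpace ℝ (Fin n) ≃ₗ[ℝ] EuclideanSpace ℝ (Fin n))),
    Finite Γ ∧
      IsLocallyDiffeomorphicAt x (MulAction.orbitRel.Quotient Γ (EuclideanSpace ℝ (Fin n)))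

/-! ### Haefliger's definition -/

/-- A triple `(Ũ, G, π)` on the space `Q`: `Ũ` is an open ball in some `ℝⁿ`, `G` is a finite
group of diffeomorphisms of `Ũ`, and `π : Ũ → Q` induces a homeomorphism of `Ũ/G` onto an open
subset of `Q`. -/
structure UniformizingChart (Q : Type*) [TopologicalSpace Q] where
  dim : ℕ
  center : EuclideanSpace ℝ (Fin dim)
  radius : ℝ
  radius_pos : 0 < radius
  group : Subgroup (Equiv.Perm (Metric.ball center radius))
  finite_group : Finite group
  /-- Every element of the group, hence also its inverse, is smooth. -/
  smooth_group : ∀ g ∈ group, ∃ f : EuclideanSpace ℝ (Fin dim) → EuclideanSpace ℝ (Fin dim),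
    ContDiffOn ℝ ∞ f (Metric.ball center radius) ∧
      ∀ u : Metric.ball center radius, ((g u : Metric.ball center radius) : _) = f u
  proj : Metric.ball center radius → Q
  induces_homeomorph : ∃ projBar : MulAction.orbitRel.Quotient group (Metric.ball center radius) → Q,
    Topology.IsOpenEmbedding projBar ∧
      ∀ u : Metric.ball center radius, projBar (Quotient.mk _ u) = proj u

namespace UniformizingChart

variable {Q : Type*} [TopologicalSpace Q]

/-- The ball `Ũ`. -/
abbrev ball (c : UniformizingChart Q) : Set (EuclideanSpace ℝ (Fin c.dim)) :=
  Metric.ball c.center c.radius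

/-- The uniformizing map `π : Ũ → Q` as a parametrization on `Q`. -/
def toParametrization (c : UniformizingChart Q) : Parametrization Q where
  dim := c.dim
  dom := c.ball
  isOpen_dom := Metric.isOpen_ball
  toFun := c.proj

end UniformizingChart

/-- Haefliger's compatibility condition: whenever `π u = π' u'` for two charts of the collection,
there is a diffeomorphism `g` from an open neighbourhood of `u` in `Ũ` onto an open neighbourhood
of `u'` in `Ũ'` such that `π' ∘ g = π` near `u`. -/
def HaefligerCompatible {Q : Type*} [TopologicalSpace Q] (F : Set (UniformizingChart Q)) : Prop :=
  ∀ c ∈ F, ∀ c' ∈ F, ∀ (u : c.ball) (u' : c'.ball), c.proj u = c'.proj u' →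
    ∃ g : OpenPartialHomeomorph (EuclideanSpace ℝ (Fin c.dim)) (EuclideanSpace ℝ (Fin c'.dim)),
      g.source ⊆ c.ball ∧ g.target ⊆ c'.ball ∧
      ContDiffOn ℝ ∞ g g.source ∧ ContDiffOn ℝ ∞ g.symm g.target ∧
      (u : EuclideanSpace ℝ (Fin c.dim)) ∈ g.source ∧
      (u' : EuclideanSpace ℝ (Fin c'.dim)) ∈ g.target ∧
      ∀ᶠ x in nhds (u : EuclideanSpace ℝ (Fin c.dim)),
        ∃ (h : x ∈ c.ball) (h' : g x ∈ c'.ball), c'.proj ⟨g x, h'⟩ = c.proj ⟨x, h⟩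

/-- A collection of charts that satisfies the compatibility condition and whose images
`U = π(Ũ)` cover `Q`. -/
structure IsHaefligerAtlas {Q : Type*} [TopologicalSpace Q] (F : Set (UniformizingChart Q)) :
    Prop where
  compatible : HaefligerCompatible F
  covers : ⋃ c ∈ F, Set.range c.proj = Set.univ

/-- The diffeology on `Q` generated by the uniformizing maps of a collection of charts. -/
@[reducible] def chartDiffeology {Q : Type*} [TopologicalSpace Q] (F : Set (UniformizingChart Q)) :
    DiffeologicalSpace Q :=
  generatedDiffeology (UniformizingChart.toParametrization '' F)

/-! The notion that carries the proof is `IsLocalSubductionOn`: a map that is locally a plot and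
along which every plot lifts smoothly near a given parameter, the lift passing through any
prescribed point of the fibre.

For the charts of an atlas, Haefliger's condition supplies exactly these lifts for the generated
diffeology. Conversely, let two charts be local subductions for one diffeology. Over a common point
they lift along each other by germs `h` and `k`. Then `k ∘ h` moves points within orbits, so at each
point it agrees with some element of a finite group. By a Baire argument its derivative is that of a
group element (`exists_fderiv_eq_of_eventually_exists_eq`), hence invertible. The same holds for `h
∘ k`, so `h` is a local diffeomorphism and the charts are compatible. Local subductions that cover
the space also generate its diffeology (`chartDiffeology_eq`), and (2) follows.

For (1), averaging over the isotropy group linearizes its action (`exists_linearization`). A chart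
and the projection `ℝⁿ → ℝⁿ/Γ` become local subductions with the same fibres, so their targets are
locally diffeomorphic.

For (3), a local diffeomorphism pulls that projection back to a local subduction into `Q`. In an
invariant Euclidean norm, a small ball is stable under the stabilizer of its centre and gives a
uniformizing chart for the D-topology. All charts that are local subductions form the atlas. -/

/-! ### Germs of smooth lifts -/

/-- The germ of `p` at `t` factors smoothly through the germ of `φ` at `a`. -/
def LiftsAt {X : Type*} {n m : ℕ} (φ : EuclideanSpace ℝ (Fin n) → X)
    (a : EuclideanSpace ℝ (Fin n)) (p : EuclideanSpace ℝ (Fin m) → X)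
    (t : EuclideanSpace ℝ (Fin m)) : Prop :=
  ∃ h : EuclideanSpace ℝ (Fin m) → EuclideanSpace ℝ (Fin n), h t = a ∧
    -- Smoothness is asked at all nearby points: `ContDiffAt ℝ ∞` at `t` alone gives `C^k` only on
    -- neighbourhoods that may shrink with `k`.
    ∀ᶠ s in nhds t, ContDiffAt ℝ ∞ h s ∧ φ (h s) = p s

theorem LiftsAt.eq {X : Type*} {n m : ℕ} {φ : EuclideanSpace ℝ (Fin n) → X}
    {a : EuclideanSpace ℝ (Fin n)} {p : EuclideanSpace ℝ (Fin m) → X}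
    {t : EuclideanSpace ℝ (Fin m)} (h : LiftsAt φ a p t) : φ a = p t := by
  obtain ⟨h, rfl, hh⟩ := h
  exact hh.self_of_nhds.2

theorem LiftsAt.refl {X : Type*} {n : ℕ} (φ : EuclideanSpace ℝ (Fin n) → X)
    (a : EuclideanSpace ℝ (Fin n)) : LiftsAt φ a φ a :=
  ⟨id, rfl, Filter.Eventually.of_forall fun _ => ⟨contDiffAt_id, rfl⟩⟩

theorem LiftsAt.trans {X : Type*} {n m k : ℕ} {φ : EuclideanSpace ℝ (Fin n) → X}
    {a : EuclideanSpace ℝ (Fin n)} {p : EuclideanSpace ℝ (Fin m) → X}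
    {t : EuclideanSpace ℝ (Fin m)} {q : EuclideanSpace ℝ (Fin k) → X}
    {r : EuclideanSpace ℝ (Fin k)} (h₁ : LiftsAt φ a p t) (h₂ : LiftsAt p t q r) :
    LiftsAt φ a q r := by
  obtain ⟨h, rfl, hh⟩ := h₁
  obtain ⟨g, rfl, hg⟩ := h₂
  refine ⟨h ∘ g, rfl, ?_⟩
  filter_upwards [hg, hg.self_of_nhds.1.continuousAt.eventually hh] with s hs hs'
  exact ⟨hs'.1.comp s hs.1, hs'.2.trans hs.2⟩

theorem LiftsAt.of_comp {X : Type*} {n m : ℕ} (φ : EuclideanSpace ℝ (Fin n) → X)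
    {h : EuclideanSpace ℝ (Fin m) → EuclideanSpace ℝ (Fin n)} {t : EuclideanSpace ℝ (Fin m)}
    (hh : ∀ᶠ s in nhds t, ContDiffAt ℝ ∞ h s) : LiftsAt φ (h t) (φ ∘ h) t :=
  ⟨h, rfl, hh.mono fun _ hs => ⟨hs, rfl⟩⟩

theorem LiftsAt.congr {X : Type*} {n m : ℕ} {φ : EuclideanSpace ℝ (Fin n) → X}
    {a : EuclideanSpace ℝ (Fin n)} {p q : EuclideanSpace ℝ (Fin m) → X}
    {t : EuclideanSpace ℝ (Fin m)} (h : LiftsAt φ a p t) (hpq : p =ᶠ[nhds t] q) :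
    LiftsAt φ a q t := by
  obtain ⟨h, rfl, hh⟩ := h
  refine ⟨h, rfl, ?_⟩
  filter_upwards [hh, hpq] with s hs hs'
  exact ⟨hs.1, hs.2.trans hs'⟩

theorem LiftsAt.comp_left {X Y : Type*} {n m : ℕ} {φ : EuclideanSpace ℝ (Fin n) → X}
    {a : EuclideanSpace ℝ (Fin n)} {p : EuclideanSpace ℝ (Fin m) → X}
    {t : EuclideanSpace ℝ (Fin m)} (h : LiftsAt φ a p t) (f : X → Y) :
    LiftsAt (f ∘ φ) a (f ∘ p) t := by
  obtain ⟨h, rfl, hh⟩ := h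
  exact ⟨h, rfl, hh.mono fun _ hs => ⟨hs.1, congrArg f hs.2⟩⟩

/-- A property that holds for the values of `φ` near `a` holds for the values of a germ that
lifts along `φ`. -/
theorem LiftsAt.eventually {X : Type*} {n m : ℕ} {φ : EuclideanSpace ℝ (Fin n) → X}
    {a : EuclideanSpace ℝ (Fin n)} {p : EuclideanSpace ℝ (Fin m) → X}
    {t : EuclideanSpace ℝ (Fin m)} (h : LiftsAt φ a p t) {P : X → Prop}
    (hP : ∀ᶠ x in nhds a, P (φ x)) : ∀ᶠ s in nhds t, P (p s) := by
  obtain ⟨h, rfl, hh⟩ := h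
  filter_upwards [hh, hh.self_of_nhds.1.continuousAt.eventually hP] with s hs hs'
  rwa [← hs.2]

/-! ### Plots as a local notion -/

/-- The map `p` is a plot near `t`. -/
def PlotAt {X : Type*} [DiffeologicalSpace X] {m : ℕ} (p : EuclideanSpace ℝ (Fin m) → X)
    (t : EuclideanSpace ℝ (Fin m)) : Prop :=
  ∃ (k : ℕ) (P : EuclideanSpace ℝ (Fin k) → X) (a : EuclideanSpace ℝ (Fin k)),
    IsPlot P ∧ LiftsAt P a p t

section PlotAt

variable {X : Type*} [DiffeologicalSpace X] {n m : ℕ}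

theorem PlotAt.of_liftsAt {p : EuclideanSpace ℝ (Fin n) → X} {t : EuclideanSpace ℝ (Fin n)}
    {q : EuclideanSpace ℝ (Fin m) → X} {r : EuclideanSpace ℝ (Fin m)} (hp : PlotAt p t)
    (h : LiftsAt p t q r) : PlotAt q r := by
  obtain ⟨k, P, a, hP, hl⟩ := hp
  exact ⟨k, P, a, hP, hl.trans h⟩

theorem isPlot_iff_forall_plotAt {p : EuclideanSpace ℝ (Fin n) → X} :
    IsPlot p ↔ ∀ t, PlotAt p t := by
  refine ⟨fun h t => ⟨n, p, t, h, .refl p t⟩, fun h => DiffeologicalSpace.locality fun x => ?_⟩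
  obtain ⟨k, P, a, hP, g, -, hg⟩ := h x
  obtain ⟨u, hu, huo, hxu⟩ := eventually_nhds_iff.1 hg
  refine ⟨u, huo, hxu, fun {m f} hfu hf => ?_⟩
  have h1 : p ∘ f = P ∘ (g ∘ f) := funext fun y => (hu _ (hfu y)).2.symm
  rw [h1]
  exact DiffeologicalSpace.plot_reparam hP
    (contDiff_iff_contDiffAt.2 fun y => (hu _ (hfu y)).1.comp y hf.contDiffAt)

/-- Replaces a partially defined map by germs of a total extension; since `U` is open, the values of
`p'` outside `U` do not matter. -/
theorem isPlotOn_iff {U : Set (EuclideanSpace ℝ (Fin n))} {p : U → X}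
    {p' : EuclideanSpace ℝ (Fin n) → X} (hp' : ∀ s : U, p' s = p s) :
    IsPlotOn p ↔ IsOpen U ∧ ∀ t ∈ U, PlotAt p' t := by
  refine ⟨fun h => ⟨h.1, fun t ht => ?_⟩, fun h => ⟨h.1, fun m f hf hfU => ?_⟩⟩
  · obtain ⟨e, e', W, hW, htW, he, he', heU, hee⟩ := exists_euclidean_reparam h.1 ht
    refine ⟨n, _, e' t, h.2 n e he heU, e', rfl, ?_⟩
    filter_upwards [hW.mem_nhds htW] with s hs
    exact ⟨he'.contDiffAt (hW.mem_nhds hs), by rw [← hp']; exact congrArg p' (hee s hs)⟩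
  · have h1 : (fun x => p ⟨f x, hfU x⟩) = p' ∘ f := funext fun x => (hp' ⟨f x, hfU x⟩).symm
    rw [h1, isPlot_iff_forall_plotAt]
    exact fun t => (h.2 _ (hfU t)).of_liftsAt
      (.of_comp _ (Filter.Eventually.of_forall fun _ => hf.contDiffAt))

theorem plotAt_euclidean_iff {p : EuclideanSpace ℝ (Fin m) → EuclideanSpace ℝ (Fin n)}
    {t : EuclideanSpace ℝ (Fin m)} : PlotAt p t ↔ ∀ᶠ s in nhds t, ContDiffAt ℝ ∞ p s := by
  constructor
  · rintro ⟨k, P, a, hP, h, -, hh⟩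
    filter_upwards [hh.eventually_nhds] with s hs
    have h1 : p =ᶠ[nhds s] P ∘ h := hs.mono fun _ h => h.2.symm
    exact ((hP.contDiff.contDiffAt).comp s hs.self_of_nhds.1).congr_of_eventuallyEq h1
  · exact fun h => ⟨n, id, p t, isPlot_id, p, rfl, h.mono fun _ hs => ⟨hs, rfl⟩⟩

end PlotAt

/-! ### Local subductions -/

/-- The map `α` is, on the open set `V`, a plot along which all plots lift locally, with a
prescribed value of the lift. -/
structure IsLocalSubductionOn {X : Type*} [DiffeologicalSpace X] {n : ℕ}
    (α : EuclideanSpace ℝ (Fin n) → X) (V : Set (EuclideanSpace ℝ (Fin n))) : Prop where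
  isOpen : IsOpen V
  plotAt : ∀ v ∈ V, PlotAt α v
  liftsAt_of_isPlot : ∀ v ∈ V, ∀ (m : ℕ) (p : EuclideanSpace ℝ (Fin m) → X)
    (t : EuclideanSpace ℝ (Fin m)), IsPlot p → p t = α v → LiftsAt α v p t

namespace IsLocalSubductionOn

variable {X Y : Type*} [DiffeologicalSpace X] [DiffeologicalSpace Y] {n m : ℕ}
  {α : EuclideanSpace ℝ (Fin n) → X} {V : Set (EuclideanSpace ℝ (Fin n))}

/-- A germ of a plot factors through a global plot; lift that one and compose. -/
theorem liftsAt (hα : IsLocalSubductionOn α V) {v : EuclideanSpace ℝ (Fin n)} (hv : v ∈ V)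
    {p : EuclideanSpace ℝ (Fin m) → X} {t : EuclideanSpace ℝ (Fin m)} (hp : PlotAt p t)
    (h : p t = α v) : LiftsAt α v p t := by
  obtain ⟨k, P, a, hP, hl⟩ := hp
  exact (hα.liftsAt_of_isPlot v hv k P a hP (hl.eq.trans h)).trans hl

theorem mono (hα : IsLocalSubductionOn α V) {W : Set (EuclideanSpace ℝ (Fin n))}
    (hW : IsOpen W) (hWV : W ⊆ V) : IsLocalSubductionOn α W :=
  ⟨hW, fun v hv => hα.plotAt v (hWV hv), fun v hv => hα.liftsAt_of_isPlot v (hWV hv)⟩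

theorem congr (hα : IsLocalSubductionOn α V) {β : EuclideanSpace ℝ (Fin n) → X}
    (h : Set.EqOn α β V) : IsLocalSubductionOn β V := by
  have key : ∀ v ∈ V, α =ᶠ[nhds v] β := fun v hv =>
    Filter.eventuallyEq_of_mem (hα.isOpen.mem_nhds hv) h
  refine ⟨hα.isOpen, fun v hv => (hα.plotAt v hv).of_liftsAt ((LiftsAt.refl α v).congr (key v hv)),
    fun v hv m p t hp hpt => ?_⟩
  exact ((LiftsAt.refl β v).congr (key v hv).symm).trans
    (hα.liftsAt_of_isPlot v hv m p t hp (hpt.trans (h hv).symm))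

/-- Precomposition of a local subduction with a local diffeomorphism. -/
theorem comp_openPartialHomeomorph (hα : IsLocalSubductionOn α V)
    (φ : OpenPartialHomeomorph (EuclideanSpace ℝ (Fin m)) (EuclideanSpace ℝ (Fin n)))
    (hφ : ContDiffOn ℝ ∞ φ φ.source) (hφ' : ContDiffOn ℝ ∞ φ.symm φ.target)
    (hV : φ.target ⊆ V) : IsLocalSubductionOn (α ∘ φ) φ.source := by
  refine ⟨φ.open_source, fun v hv => ?_, fun v hv m p t hp hpt => ?_⟩
  · refine (hα.plotAt _ (hV (φ.map_source hv))).of_liftsAt (.of_comp _ ?_)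
    filter_upwards [φ.open_source.mem_nhds hv] with s hs
    exact hφ.contDiffAt (φ.open_source.mem_nhds hs)
  · refine LiftsAt.trans ?_ (hα.liftsAt_of_isPlot _ (hV (φ.map_source hv)) m p t hp hpt)
    refine ⟨φ.symm, φ.left_inv hv, ?_⟩
    filter_upwards [φ.open_target.mem_nhds (φ.map_source hv)] with s hs
    exact ⟨hφ'.contDiffAt (φ.open_target.mem_nhds hs), congrArg α (φ.right_inv hs)⟩

/-- Two local subductions with the same fibres define a local diffeomorphism between their
targets. -/
theorem isLocallyDiffeomorphicAt (hα : IsLocalSubductionOn α V)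
    {β : EuclideanSpace ℝ (Fin n) → Y} (hβ : IsLocalSubductionOn β V)
    (h : ∀ v ∈ V, ∀ w ∈ V, α v = α w ↔ β v = β w) {v : EuclideanSpace ℝ (Fin n)} (hv : v ∈ V) :
    IsLocallyDiffeomorphicAt (α v) Y := by
  -- A set-theoretic section suffices: equality of fibres makes `β ∘ σ` independent of the choice,
  -- and smoothness will come from lifts, not from `σ`.
  choose σ hσV hσ using fun x : α '' V => x.2
  let f : α '' V → Y := fun x => β (σ x)
  have hfα : ∀ v (hv : v ∈ V), f ⟨α v, v, hv, rfl⟩ = β v := fun v hv =>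
    (h _ (hσV _) _ hv).1 (hσ _)
  have hf : Function.Injective f := fun x y hxy =>
    Subtype.ext (by rw [← hσ x, ← hσ y]; exact (h _ (hσV _) _ (hσV _)).2 hxy)
  refine ⟨α '' V, ⟨v, hv, rfl⟩, f, hf, fun n p hp => ?_, fun n q hq => ?_⟩
  · classical
    let f' : X → Y := fun x => if hx : x ∈ α '' V then f ⟨x, hx⟩ else β v
    have hf' : ∀ v ∈ V, f' (α v) = β v := fun v hv => by
      have : α v ∈ α '' V := ⟨v, hv, rfl⟩
      simp only [f', dif_pos this]
      exact hfα v hv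
    have hf'A : ∀ x : α '' V, f' x = f x := fun x => dif_pos x.2
    rw [isPlotOn_iff (p' := f' ∘ p) fun s => hf'A ⟨p s, s.2⟩, isOpen_iff_eventually]
    refine ⟨fun t ht => ?_, fun t ht => ?_⟩
    · obtain ⟨w, hw, hwt⟩ := ht
      exact (hα.liftsAt_of_isPlot w hw _ p t hp hwt.symm).eventually (P := (· ∈ α '' V))
        (Filter.mem_of_superset (hα.isOpen.mem_nhds hw) fun x hx => ⟨x, hx, rfl⟩)
    · obtain ⟨w, hw, hwt⟩ := ht
      -- Near `t` one has `p = α ∘ h` with `h` smooth, hence `f' ∘ p = β ∘ h`.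
      refine (hβ.plotAt w hw).of_liftsAt (LiftsAt.trans ?_
        ((hα.liftsAt_of_isPlot w hw _ p t hp hwt.symm).comp_left f'))
      exact (LiftsAt.refl β w).congr
        (Filter.eventuallyEq_of_mem (hα.isOpen.mem_nhds hw) fun x hx => (hf' x hx).symm)
  · classical
    let k : Y → X := fun y => if hy : y ∈ Set.range f then
      ((Equiv.ofInjective f hf).symm ⟨y, hy⟩ : X) else α v
    have hrange : ∀ v ∈ V, β v ∈ Set.range f := fun v hv => ⟨_, hfα v hv⟩
    have hk : ∀ v ∈ V, k (β v) = α v := fun v hv => by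
      simp only [k, dif_pos (hrange v hv)]
      have : (⟨β v, hrange v hv⟩ : Set.range f) =
          Equiv.ofInjective f hf ⟨α v, v, hv, rfl⟩ := Subtype.ext (hfα v hv).symm
      rw [this, Equiv.symm_apply_apply]
    have hkA : ∀ y : Set.range f, k y = (Equiv.ofInjective f hf).symm y := fun y => dif_pos y.2
    rw [isPlotOn_iff (p' := k ∘ q) fun s => hkA ⟨q s, s.2⟩, isOpen_iff_eventually]
    refine ⟨fun t ht => ?_, fun t ht => ?_⟩
    · obtain ⟨x, hx⟩ := ht
      exact (hβ.liftsAt_of_isPlot _ (hσV x) _ q t hq hx.symm).eventually (P := (· ∈ Set.range f))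
        (Filter.mem_of_superset (hβ.isOpen.mem_nhds (hσV x)) hrange)
    · obtain ⟨x, hx⟩ := ht
      refine (hα.plotAt _ (hσV x)).of_liftsAt (LiftsAt.trans ?_
        ((hβ.liftsAt_of_isPlot _ (hσV x) _ q t hq hx.symm).comp_left k))
      exact (LiftsAt.refl α _).congr
        (Filter.eventuallyEq_of_mem (hα.isOpen.mem_nhds (hσV x)) fun x hx => (hk x hx).symm)

end IsLocalSubductionOn

/-- A local diffeomorphism pulls back a local subduction onto its target. -/
theorem IsLocallyDiffeomorphicAt.exists_isLocalSubductionOn {X Y : Type*} [DiffeologicalSpace X]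
    [DiffeologicalSpace Y] {x : X} (hx : IsLocallyDiffeomorphicAt x Y) {n : ℕ}
    {β : EuclideanSpace ℝ (Fin n) → Y} (hβ : IsLocalSubductionOn β Set.univ)
    (hsurj : Function.Surjective β) :
    ∃ (α : EuclideanSpace ℝ (Fin n) → X) (V : Set (EuclideanSpace ℝ (Fin n))),
      IsLocalSubductionOn α V ∧ (∃ v ∈ V, α v = x) ∧
        ∀ v ∈ V, ∀ w ∈ V, α v = α w ↔ β v = β w := by
  classical
  obtain ⟨A, hxA, f, hf, h1, h2⟩ := hx
  let k : Y → X := fun y => if hy : y ∈ Set.range f then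
      ((Equiv.ofInjective f hf).symm ⟨y, hy⟩ : X) else x
  have hk : ∀ a : A, k (f a) = a := fun a => by
    have : (⟨f a, ⟨a, rfl⟩⟩ : Set.range f) = Equiv.ofInjective f hf a := rfl
    simp only [k, dif_pos (Set.mem_range_self a), this, Equiv.symm_apply_apply]
  let f' : X → Y := fun x' => if hx' : x' ∈ A then f ⟨x', hx'⟩ else f ⟨x, hxA⟩
  have hf' : ∀ a : A, f' a = f a := fun a => dif_pos a.2
  have h1' := fun n p hp => (isPlotOn_iff (p' := f' ∘ p) fun s => hf' ⟨p s, s.2⟩).1 (h1 n p hp)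
  have hkA : ∀ y : Set.range f, k y = (Equiv.ofInjective f hf).symm y := fun y => dif_pos y.2
  have h2' := fun n q hq => (isPlotOn_iff (p' := k ∘ q) fun s => hkA ⟨q s, s.2⟩).1 (h2 n q hq)
  obtain ⟨v, hv⟩ := hsurj (f ⟨x, hxA⟩)
  -- The pulled-back map is `f⁻¹ ∘ β` on `β⁻¹(f(A))`. To lift a plot `p`, lift `f ∘ p` along `β` and
  -- apply `f⁻¹`.
  refine ⟨k ∘ β, β ⁻¹' Set.range f, ⟨?_, ?_, ?_⟩, ⟨v, ⟨_, hv.symm⟩, ?_⟩, ?_⟩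
  · rw [isOpen_iff_eventually]
    intro v hv
    obtain ⟨m, P, a, hP, hl⟩ := hβ.plotAt v trivial
    refine hl.eventually (P := (· ∈ Set.range f)) ((h2' m P hP).1.mem_nhds ?_)
    rw [Set.mem_preimage, hl.eq]
    exact hv
  · intro v hv
    obtain ⟨m, P, a, hP, hl⟩ := hβ.plotAt v trivial
    refine ((h2' m P hP).2 a ?_).of_liftsAt (hl.comp_left k)
    rw [Set.mem_preimage, hl.eq]
    exact hv
  · rintro v ⟨a, ha⟩ m p t hp hpt
    have hpt' : p t = a := by rw [hpt, Function.comp_apply, ← ha, hk]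
    have htA : t ∈ p ⁻¹' A := by rw [Set.mem_preimage, hpt']; exact a.2
    have hl := hβ.liftsAt (v := v) trivial ((h1' m p hp).2 t htA)
      (by rw [Function.comp_apply, hpt', hf', ha])
    refine (hl.comp_left k).congr (Filter.eventuallyEq_of_mem ((h1' m p hp).1.mem_nhds htA) ?_)
    intro s hs
    have := hf' ⟨p s, hs⟩
    simp only [Function.comp_apply] at this ⊢
    rw [this, hk]
  · rw [Function.comp_apply, hv, hk]
  · rintro v ⟨a, ha⟩ w ⟨b, hb⟩
    rw [Function.comp_apply, Function.comp_apply, ← ha, ← hb, hk, hk, hf.eq_iff, Subtype.ext_iff]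

/-- The projection of `ℝⁿ` to its quotient by a group of linear automorphisms. -/
theorem isLocalSubductionOn_quotientMk {n : ℕ}
    (Γ : Subgroup (EuclideanSpace ℝ (Fin n) ≃ₗ[ℝ] EuclideanSpace ℝ (Fin n))) :
    IsLocalSubductionOn
      (Quotient.mk _ : EuclideanSpace ℝ (Fin n) →
        MulAction.orbitRel.Quotient Γ (EuclideanSpace ℝ (Fin n))) Set.univ := by
  refine ⟨isOpen_univ, fun v _ => ?_, fun v _ m p t hp hpt => ?_⟩
  · refine isPlot_iff_forall_plotAt.1 (fun x => ⟨Set.univ, isOpen_univ, trivial, fun y => y,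
      (isPlotOn_iff (p' := id) fun _ => rfl).2 ⟨isOpen_univ, fun t _ => ?_⟩, fun _ => rfl⟩) v
    exact isPlot_iff_forall_plotAt.1 isPlot_id t
  · obtain ⟨W, hW, htW, q, hq, hpq⟩ := hp t
    classical
    let q' : EuclideanSpace ℝ (Fin m) → EuclideanSpace ℝ (Fin n) :=
      fun s => if hs : s ∈ W then q ⟨s, hs⟩ else 0
    have hq' : ∀ s : W, q' s = q s := fun s => dif_pos s.2
    have hs := plotAt_euclidean_iff.1 (((isPlotOn_iff hq').1 hq).2 t htW)
    have h1 : (Quotient.mk _ (q' t) : MulAction.orbitRel.Quotient Γ (EuclideanSpace ℝ (Fin n))) =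
        Quotient.mk _ v := by
      rw [← hpt, hpq ⟨t, htW⟩, hq' ⟨t, htW⟩]
    -- The given lift passes through some point of the orbit of `v`; translating it by `γ` makes it
    -- pass through `v` itself.
    obtain ⟨γ, hγ⟩ := Quotient.exact h1.symm
    refine ⟨fun s => γ • q' s, hγ, ?_⟩
    filter_upwards [hs, hW.mem_nhds htW] with s hs hsW
    refine ⟨?_, ?_⟩
    · exact (γ.1.toContinuousLinearEquiv.contDiff.contDiffAt).comp s hs
    · refine Eq.trans ?_ (hpq ⟨s, hsW⟩).symm
      rw [← hq' ⟨s, hsW⟩]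
      exact Quotient.sound ⟨γ, rfl⟩

/-! ### Two facts from calculus -/

/-- A map that takes at each point one of the values of finitely many maps has at each point the
derivative of one of them. -/
theorem exists_fderiv_eq_of_eventually_exists_eq {E F ι : Type*} [NormedAddCommGroup E]
    [NormedSpace ℝ E] [CompleteSpace E] [NormedAddCommGroup F] [NormedSpace ℝ F] [Finite ι]
    {f : E → F} {g : ι → E → F} {u : E} (hf : ∀ᶠ x in nhds u, ContDiffAt ℝ ∞ f x)
    (hg : ∀ i, ∀ᶠ x in nhds u, ContDiffAt ℝ ∞ (g i) x)
    (h : ∀ᶠ x in nhds u, ∃ i, f x = g i x) : ∃ i, fderiv ℝ f u = fderiv ℝ (g i) u := by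
  have hg' := Filter.eventually_all.2 hg
  have : Nonempty ι := let ⟨i, _⟩ := h.self_of_nhds; ⟨i⟩
  have key : ∃ᶠ x in nhds u, ∃ i, fderiv ℝ f x = fderiv ℝ (g i) x := by
    rw [frequently_nhds_iff]
    intro U huU hU
    obtain ⟨W, hW, hWo, huW⟩ := eventually_nhds_iff.1
      ((hU.eventually_mem huU).and (hf.and (hg'.and h)))
    let A : ι → Set E := fun i => {x | x ∈ W ∧ f x = g i x}
    -- Baire: finitely many closed sets cover the space, so their interiors are dense. Near a point
    -- of `W` in such an interior, `f = g i` on a dense subset, hence everywhere by continuity.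
    have hd := dense_iUnion_interior_of_closed (f := fun i => closure (A i) ∪ Wᶜ)
      (fun i => isClosed_closure.union hWo.isClosed_compl) (by
        refine Set.eq_univ_of_forall fun x => ?_
        by_cases hx : x ∈ W
        · obtain ⟨i, hi⟩ := (hW x hx).2.2.2
          exact Set.mem_iUnion.2 ⟨i, Or.inl (subset_closure ⟨hx, hi⟩)⟩
        · exact Set.mem_iUnion.2 ⟨Classical.arbitrary ι, Or.inr hx⟩)
    obtain ⟨x, hxW, hx⟩ := hd.inter_open_nonempty W hWo ⟨u, huW⟩
    obtain ⟨i, hi⟩ := Set.mem_iUnion.1 hx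
    refine ⟨x, (hW x hxW).1, i, Filter.EventuallyEq.fderiv_eq ?_⟩
    filter_upwards [hWo.mem_nhds hxW, mem_interior_iff_mem_nhds.1 hi] with y hyW hy
    have hy' := hy.resolve_right fun hn => hn hyW
    exact tendsto_nhds_unique_of_frequently_eq (hW y hyW).2.1.continuousAt
      ((hW y hyW).2.2.1 i).continuousAt
      ((mem_closure_iff_frequently.1 hy').mono fun z hz => hz.2)
  -- Since `ι` is finite, one index serves at points arbitrarily close to `u`; continuity of the
  -- derivatives carries the equality to `u`.
  obtain ⟨i, hi⟩ := Filter.frequently_exists.1 key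
  have hc : ∀ {k : E → F}, ContDiffAt ℝ ∞ k u → ContinuousAt (fderiv ℝ k) u := fun hk =>
    (hk.fderiv_right (m := 0) (by norm_num)).continuousAt
  exact ⟨i, tendsto_nhds_unique_of_frequently_eq (hc hf.self_of_nhds) (hc (hg i).self_of_nhds) hi⟩

/-- The inverse function theorem for smooth maps, with control of the source. -/
theorem exists_openPartialHomeomorph_of_bijective_fderiv {E F : Type*} [NormedAddCommGroup E]
    [NormedSpace ℝ E] [CompleteSpace E] [NormedAddCommGroup F] [NormedSpace ℝ F] [CompleteSpace F]
    {f : E → F} {u : E} (hf : ∀ᶠ x in nhds u, ContDiffAt ℝ ∞ f x)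
    (hb : Function.Bijective (fderiv ℝ f u)) {W : Set E} (hW : W ∈ nhds u) :
    ∃ e : OpenPartialHomeomorph E F, ⇑e = f ∧ u ∈ e.source ∧ e.source ⊆ W ∧
      ContDiffOn ℝ ∞ e e.source ∧ ContDiffOn ℝ ∞ e.symm e.target := by
  let L : E ≃L[ℝ] F := ContinuousLinearEquiv.ofBijective (fderiv ℝ f u)
    (LinearMap.ker_eq_bot.2 hb.1) (LinearMap.range_eq_top.2 hb.2)
  have hL : (L : E →L[ℝ] F) = fderiv ℝ f u := ContinuousLinearEquiv.coe_ofBijective _ _ _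
  have hfu := hf.self_of_nhds
  -- Invertibility of the derivative is an open condition; restricting to where it holds makes the
  -- inverse smooth on the whole target, not just at `f u`.
  have hinv : ∀ᶠ x in nhds u, fderiv ℝ f x ∈ Set.range ((↑) : (E ≃L[ℝ] F) → E →L[ℝ] F) :=
    (hfu.fderiv_right (m := 0) (by norm_num)).continuousAt.eventually
      (hL ▸ ContinuousLinearEquiv.nhds L)
  obtain ⟨O, hO, hOo, huO⟩ := eventually_nhds_iff.1
    ((Filter.eventually_mem_set.2 hW).and (hf.and hinv))
  let e₀ := hfu.toOpenPartialHomeomorph f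
    (hL ▸ (hfu.differentiableAt (by norm_num)).hasFDerivAt) (by norm_num)
  have hsrc : ∀ x ∈ (e₀.restrOpen O hOo).source, x ∈ O := fun x hx => by
    rw [OpenPartialHomeomorph.restrOpen_source] at hx
    exact hx.2
  refine ⟨e₀.restrOpen O hOo, rfl, ?_, fun x hx => (hO x (hsrc x hx)).1,
    fun x hx => (hO x (hsrc x hx)).2.1.contDiffWithinAt, fun y hy => ?_⟩
  · rw [OpenPartialHomeomorph.restrOpen_source]
    exact ⟨hfu.mem_toOpenPartialHomeomorph_source _ (by norm_num), huO⟩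
  · have hx := hO _ (hsrc _ ((e₀.restrOpen O hOo).map_target hy))
    obtain ⟨L', hL'⟩ := hx.2.2
    refine ((e₀.restrOpen O hOo).contDiffAt_symm hy (f₀' := L') ?_ hx.2.1).contDiffWithinAt
    rw [hL']
    exact (hx.2.1.differentiableAt (by norm_num)).hasFDerivAt

/-! ### Uniformizing charts as maps on the whole space -/

namespace UniformizingChart

variable {Q : Type*} [TopologicalSpace Q] (c : UniformizingChart Q)

theorem center_mem : c.center ∈ c.ball := Metric.mem_ball_self c.radius_pos

open Classical in
/-- An extension of the uniformizing map to the whole space. -/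
noncomputable def ext (x : EuclideanSpace ℝ (Fin c.dim)) : Q :=
  if h : x ∈ c.ball then c.proj ⟨x, h⟩ else c.proj ⟨c.center, c.center_mem⟩

theorem ext_of_mem {x : EuclideanSpace ℝ (Fin c.dim)} (h : x ∈ c.ball) :
    c.ext x = c.proj ⟨x, h⟩ :=
  dif_pos h

open Classical in
/-- The extension of an element of the group by the identity. -/
noncomputable def extPerm (g : c.group) (x : EuclideanSpace ℝ (Fin c.dim)) :
    EuclideanSpace ℝ (Fin c.dim) :=
  if h : x ∈ c.ball then g.1 ⟨x, h⟩ else x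

variable {c} {x y : EuclideanSpace ℝ (Fin c.dim)} (g g' : c.group)

theorem extPerm_of_mem (h : x ∈ c.ball) : c.extPerm g x = g.1 ⟨x, h⟩ :=
  dif_pos h

theorem extPerm_mem (h : x ∈ c.ball) : c.extPerm g x ∈ c.ball := by
  rw [extPerm_of_mem g h]
  exact Subtype.property _

theorem extPerm_one : c.extPerm 1 = id := by
  ext1 x
  unfold extPerm
  split_ifs <;> rfl

theorem extPerm_mul (x : EuclideanSpace ℝ (Fin c.dim)) :
    c.extPerm (g * g') x = c.extPerm g (c.extPerm g' x) := by
  by_cases h : x ∈ c.ball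
  · rw [extPerm_of_mem _ (extPerm_mem g' h), extPerm_of_mem _ h]
    congr 1
    exact congrArg g.1 (Subtype.ext (extPerm_of_mem g' h).symm)
  · have h1 (k : c.group) : c.extPerm k x = x := dif_neg h
    rw [h1, h1, h1]

theorem extPerm_inv_apply (x : EuclideanSpace ℝ (Fin c.dim)) :
    c.extPerm g⁻¹ (c.extPerm g x) = x := by
  rw [← extPerm_mul, inv_mul_cancel, extPerm_one, id]

theorem ball_mem_nhds (h : x ∈ c.ball) : c.ball ∈ nhds x :=
  Metric.isOpen_ball.mem_nhds h

theorem contDiffAt_extPerm (h : x ∈ c.ball) : ContDiffAt ℝ ∞ (c.extPerm g) x := by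
  obtain ⟨f, hf, hgf⟩ := c.smooth_group g g.2
  refine ((hf x h).contDiffAt (ball_mem_nhds h)).congr_of_eventuallyEq ?_
  filter_upwards [ball_mem_nhds h] with y hy
  rw [extPerm_of_mem g hy]
  exact hgf _

theorem eventually_contDiffAt_extPerm (h : x ∈ c.ball) :
    ∀ᶠ y in nhds x, ContDiffAt ℝ ∞ (c.extPerm g) y :=
  (Filter.eventually_mem_set.2 (ball_mem_nhds h)).mono fun _ hy => contDiffAt_extPerm g hy

theorem fderiv_extPerm_mul (h : x ∈ c.ball) :
    fderiv ℝ (c.extPerm (g * g')) x =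
      (fderiv ℝ (c.extPerm g) (c.extPerm g' x)).comp (fderiv ℝ (c.extPerm g') x) := by
  rw [show c.extPerm (g * g') = c.extPerm g ∘ c.extPerm g' from funext (extPerm_mul g g')]
  exact fderiv_comp x ((contDiffAt_extPerm g (extPerm_mem g' h)).differentiableAt (by norm_num))
    ((contDiffAt_extPerm g' h).differentiableAt (by norm_num))

theorem fderiv_extPerm_one : fderiv ℝ (c.extPerm 1) x = ContinuousLinearMap.id ℝ _ := by
  rw [extPerm_one, fderiv_id]

theorem bijective_fderiv_extPerm (h : x ∈ c.ball) :
    Function.Bijective (fderiv ℝ (c.extPerm g) x) := by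
  have h1 := fderiv_extPerm_mul g⁻¹ g h
  have h2 := fderiv_extPerm_mul g g⁻¹ (extPerm_mem g h)
  rw [inv_mul_cancel, fderiv_extPerm_one] at h1
  rw [mul_inv_cancel, fderiv_extPerm_one, extPerm_inv_apply] at h2
  exact Function.bijective_iff_has_inverse.2 ⟨fderiv ℝ (c.extPerm g⁻¹) (c.extPerm g x),
    fun v => (DFunLike.congr_fun h1 v).symm, fun v => (DFunLike.congr_fun h2 v).symm⟩

theorem ext_eq_ext_iff (hx : x ∈ c.ball) (hy : y ∈ c.ball) :
    c.ext x = c.ext y ↔ ∃ g : c.group, c.extPerm g x = y := by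
  obtain ⟨b, hb, hbc⟩ := c.induces_homeomorph
  rw [c.ext_of_mem hx, c.ext_of_mem hy, ← hbc, ← hbc, hb.injective.eq_iff, eq_comm]
  refine ⟨fun h => ?_, fun ⟨g, hg⟩ => ?_⟩
  · obtain ⟨g, hg⟩ := Quotient.exact h
    exact ⟨g, by rw [extPerm_of_mem g hx]; exact congrArg Subtype.val hg⟩
  · exact Quotient.sound ⟨g, Subtype.ext ((extPerm_of_mem g hx).symm.trans hg)⟩

/-- A smooth lift of the identity along the uniformizing map is a local diffeomorphism. -/
theorem bijective_fderiv_of_liftsAt {h : EuclideanSpace ℝ (Fin c.dim) →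
    EuclideanSpace ℝ (Fin c.dim)} (hx : x ∈ c.ball) (hhx : h x = x)
    (hh : ∀ᶠ s in nhds x, ContDiffAt ℝ ∞ h s ∧ c.ext (h s) = c.ext s) :
    Function.Bijective (fderiv ℝ h x) := by
  have := c.finite_group
  have hc := hh.self_of_nhds.1.continuousAt
  -- Near `x`, the point `h s` lies in the orbit of `s`, so `h` takes at each point the value of
  -- some group element.
  obtain ⟨g, hg⟩ := exists_fderiv_eq_of_eventually_exists_eq (g := c.extPerm)
    (hh.mono fun _ hs => hs.1) (fun g => eventually_contDiffAt_extPerm g hx) (by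
      filter_upwards [hh, ball_mem_nhds hx,
        hc.eventually (by rw [hhx]; exact ball_mem_nhds hx)] with s hs hs1 hs2
      obtain ⟨g, hg⟩ := (ext_eq_ext_iff hs1 hs2).1 hs.2.symm
      exact ⟨g, hg.symm⟩)
  rw [hg]
  exact bijective_fderiv_extPerm g hx

end UniformizingChart

/-! ### Compatibility and germs of lifts -/

namespace UniformizingChart

variable {Q : Type*} [TopologicalSpace Q] {c c' : UniformizingChart Q}

/-- Points of a ball that are identified by the uniformizing map have the same germs of it. -/
theorem liftsAt_ext_self {x y : EuclideanSpace ℝ (Fin c.dim)} (hx : x ∈ c.ball) (hy : y ∈ c.ball)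
    (h : c.ext x = c.ext y) : LiftsAt c.ext y c.ext x := by
  obtain ⟨g, hg⟩ := (ext_eq_ext_iff hx hy).1 h
  refine ⟨c.extPerm g, hg, ?_⟩
  filter_upwards [ball_mem_nhds hx] with s hs
  exact ⟨contDiffAt_extPerm g hs, ((ext_eq_ext_iff hs (extPerm_mem g hs)).2 ⟨g, rfl⟩).symm⟩

/-- Uniformizing maps that lift along each other differ by a local diffeomorphism. -/
theorem exists_openPartialHomeomorph_of_liftsAt {u : EuclideanSpace ℝ (Fin c.dim)}
    {u' : EuclideanSpace ℝ (Fin c'.dim)} (hu : u ∈ c.ball) (hu' : u' ∈ c'.ball)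
    (h₁ : LiftsAt c'.ext u' c.ext u) (h₂ : LiftsAt c.ext u c'.ext u') :
    ∃ g : OpenPartialHomeomorph (EuclideanSpace ℝ (Fin c.dim)) (EuclideanSpace ℝ (Fin c'.dim)),
      g.source ⊆ c.ball ∧ g.target ⊆ c'.ball ∧
      ContDiffOn ℝ ∞ g g.source ∧ ContDiffOn ℝ ∞ g.symm g.target ∧
      u ∈ g.source ∧ u' ∈ g.target ∧
      ∀ᶠ x in nhds u, ∃ (h : x ∈ c.ball) (h' : g x ∈ c'.ball),
        c'.proj ⟨g x, h'⟩ = c.proj ⟨x, h⟩ := by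
  obtain ⟨h, rfl, hh⟩ := h₁
  obtain ⟨k, hk, hkk⟩ := h₂
  have hhc := hh.self_of_nhds.1
  have hkc := hkk.self_of_nhds.1
  -- Both composites lift the identity. The first makes the derivative of `h` injective, the second
  -- makes it surjective; equality of dimensions is a consequence and need not be assumed.
  have b₁ : Function.Bijective (fderiv ℝ (k ∘ h) u) := by
    refine bijective_fderiv_of_liftsAt hu hk ?_
    filter_upwards [hh, hhc.continuousAt.eventually hkk] with s hs hs'
    exact ⟨hs'.1.comp s hs.1, hs'.2.trans hs.2⟩
  have b₂ : Function.Bijective (fderiv ℝ (h ∘ k) (h u)) := by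
    refine bijective_fderiv_of_liftsAt hu' (congrArg h hk) ?_
    filter_upwards [hkk, hkc.continuousAt.eventually (hk.symm ▸ hh)] with s hs hs'
    exact ⟨hs'.1.comp s hs.1, hs'.2.trans hs.2⟩
  rw [fderiv_comp u (hkc.differentiableAt (by norm_num)) (hhc.differentiableAt (by norm_num)),
    ContinuousLinearMap.coe_comp] at b₁
  rw [fderiv_comp _ (by rw [hk]; exact hhc.differentiableAt (by norm_num))
    (hkc.differentiableAt (by norm_num)), hk, ContinuousLinearMap.coe_comp] at b₂
  obtain ⟨e, rfl, hue, hesrc, he, he'⟩ := exists_openPartialHomeomorph_of_bijective_fderiv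
    (hh.mono fun _ hs => hs.1) ⟨b₁.1.of_comp, b₂.2.of_comp⟩
    (Filter.inter_mem (ball_mem_nhds hu) (hhc.continuousAt.preimage_mem_nhds (ball_mem_nhds hu')))
  refine ⟨e, fun x hx => (hesrc hx).1, fun y hy => ?_, he, he', hue, e.map_source hue, ?_⟩
  · have := (hesrc (e.map_target hy)).2
    rwa [Set.mem_preimage, e.right_inv hy] at this
  · filter_upwards [hh, e.open_source.mem_nhds hue] with s hs hse
    refine ⟨(hesrc hse).1, (hesrc hse).2, ?_⟩
    rw [← ext_of_mem, ← ext_of_mem]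
    exact hs.2

end UniformizingChart

/-! ### Atlases and the diffeologies they generate -/

section Atlas

variable {Q : Type*} [TopologicalSpace Q] {F F' : Set (UniformizingChart Q)}

theorem HaefligerCompatible.liftsAt (hF : HaefligerCompatible F) {c c' : UniformizingChart Q}
    (hc : c ∈ F) (hc' : c' ∈ F) {u : EuclideanSpace ℝ (Fin c.dim)}
    {u' : EuclideanSpace ℝ (Fin c'.dim)} (hu : u ∈ c.ball) (hu' : u' ∈ c'.ball)
    (h : c.ext u = c'.ext u') : LiftsAt c'.ext u' c.ext u := by
  obtain ⟨g, -, -, hg, -, hgu, -, hproj⟩ := hF c hc c' hc' ⟨u, hu⟩ ⟨u', hu'⟩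
    (by rwa [c.ext_of_mem hu, c'.ext_of_mem hu'] at h)
  have hext : ∀ᶠ x in nhds u, g x ∈ c'.ball ∧ c'.ext (g x) = c.ext x := by
    filter_upwards [hproj] with x hx
    obtain ⟨h1, h2, h3⟩ := hx
    exact ⟨h2, by rwa [c.ext_of_mem h1, c'.ext_of_mem h2]⟩
  -- The compatibility condition does not say `g u = u'`, but both lie over the same point, so an
  -- element of the group of `c'` corrects the lift.
  refine (UniformizingChart.liftsAt_ext_self hext.self_of_nhds.1 hu'
    (hext.self_of_nhds.2.trans h)).trans ⟨g, rfl, ?_⟩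
  filter_upwards [hext, g.open_source.mem_nhds hgu] with s hs hsg
  exact ⟨hg.contDiffAt (g.open_source.mem_nhds hsg), hs.2⟩

theorem haefligerCompatible_of_liftsAt
    (h : ∀ c ∈ F, ∀ c' ∈ F, ∀ u ∈ c.ball, ∀ u' ∈ c'.ball, c.ext u = c'.ext u' →
      LiftsAt c'.ext u' c.ext u) : HaefligerCompatible F := by
  intro c hc c' hc' u u' huu
  have huu' : c.ext u = c'.ext u' := by
    rw [c.ext_of_mem u.2, c'.ext_of_mem u'.2]
    exact huu
  exact UniformizingChart.exists_openPartialHomeomorph_of_liftsAt u.2 u'.2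
    (h c hc c' hc' u u.2 u' u'.2 huu') (h c' hc' c hc u' u'.2 u u.2 huu'.symm)

/-- A collection of charts that are local subductions is compatible. -/
theorem haefligerCompatible_of_isLocalSubductionOn [DiffeologicalSpace Q]
    (h : ∀ c ∈ F, IsLocalSubductionOn c.ext c.ball) : HaefligerCompatible F :=
  haefligerCompatible_of_liftsAt fun c hc c' hc' u hu _ hu' huu =>
    (h c' hc').liftsAt hu' ((h c hc).plotAt u hu) huu

theorem exists_ext_eq (hF : ⋃ c ∈ F, Set.range c.proj = Set.univ) (x : Q) :
    ∃ c ∈ F, ∃ u ∈ c.ball, c.ext u = x := by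
  have hx : x ∈ ⋃ c ∈ F, Set.range c.proj := hF ▸ Set.mem_univ x
  simp only [Set.mem_iUnion] at hx
  obtain ⟨c, hc, u, hu⟩ := hx
  exact ⟨c, hc, u, u.2, by rw [c.ext_of_mem u.2]; exact hu⟩

/-- Covering removes the separate case of constant plots: they lift to constant maps into a ball. -/
theorem isPlot_chartDiffeology_iff (hF : ⋃ c ∈ F, Set.range c.proj = Set.univ) {n : ℕ}
    {p : EuclideanSpace ℝ (Fin n) → Q} :
    @IsPlot Q (chartDiffeology F) n p ↔
      ∀ t, ∃ c ∈ F, ∃ u ∈ c.ball, LiftsAt c.ext u p t := by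
  constructor
  · intro hp t
    obtain ⟨W, hW, htW, ⟨y, hy⟩ | ⟨-, ⟨c, hc, rfl⟩, f, hf, hfW, hpf⟩⟩ := hp t
    · obtain ⟨c, hc, u, hu, rfl⟩ := exists_ext_eq hF y
      refine ⟨c, hc, u, hu, fun _ => u, rfl, ?_⟩
      filter_upwards [hW.mem_nhds htW] with s hs
      exact ⟨contDiffAt_const, (hy s hs).symm⟩
    · refine ⟨c, hc, f t, hfW t htW, f, rfl, ?_⟩
      filter_upwards [hW.mem_nhds htW] with s hs
      exact ⟨hf.contDiffAt (hW.mem_nhds hs), (c.ext_of_mem (hfW s hs)).trans (hpf s hs).symm⟩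
  · intro h t
    obtain ⟨c, hc, u, hu, f, rfl, hf⟩ := h t
    obtain ⟨W, hW, hWo, htW⟩ := eventually_nhds_iff.1 (hf.and
      (hf.self_of_nhds.1.continuousAt.eventually_mem (UniformizingChart.ball_mem_nhds hu)))
    refine ⟨W, hWo, htW, Or.inr ⟨c.toParametrization, ⟨c, hc, rfl⟩, f,
      fun s hs => (hW s hs).1.1.contDiffWithinAt, fun s hs => (hW s hs).2, fun s hs => ?_⟩⟩
    exact (hW s hs).1.2.symm.trans (c.ext_of_mem _)

theorem plotAt_chartDiffeology {c : UniformizingChart Q} (hc : c ∈ F)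
    {u : EuclideanSpace ℝ (Fin c.dim)} (hu : u ∈ c.ball) :
    @PlotAt Q (chartDiffeology F) _ c.ext u := by
  let _ := chartDiffeology F
  have h : IsPlotOn c.proj := by
    refine ⟨Metric.isOpen_ball, fun m f hf hfU x => ⟨Set.univ, isOpen_univ, trivial, Or.inr
      ⟨c.toParametrization, ⟨c, hc, rfl⟩, f, hf.contDiffOn, fun w _ => hfU w, fun w _ => rfl⟩⟩⟩
  exact ((isPlotOn_iff fun s => c.ext_of_mem s.2).1 h).2 u hu

/-- The charts of an atlas are local subductions for the diffeology they generate. -/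
theorem IsHaefligerAtlas.isLocalSubductionOn (hF : IsHaefligerAtlas F)
    {c : UniformizingChart Q} (hc : c ∈ F) :
    @IsLocalSubductionOn Q (chartDiffeology F) _ c.ext c.ball := by
  let _ := chartDiffeology F
  refine ⟨Metric.isOpen_ball, fun u hu => plotAt_chartDiffeology hc hu,
    fun u hu m p t hp hpt => ?_⟩
  obtain ⟨c', hc', u', hu', hl⟩ := (isPlot_chartDiffeology_iff hF.covers).1 hp t
  exact (hF.compatible.liftsAt hc' hc hu' hu (hl.eq.trans hpt)).trans hl

/-- Charts that are local subductions and cover the space generate its diffeology. -/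
theorem chartDiffeology_eq [d : DiffeologicalSpace Q]
    (h : ∀ c ∈ F, IsLocalSubductionOn c.ext c.ball)
    (hF : ⋃ c ∈ F, Set.range c.proj = Set.univ) : chartDiffeology F = d := by
  refine DiffeologicalSpace.ext (funext fun n => funext fun p => propext ?_)
  rw [isPlot_chartDiffeology_iff hF]
  refine ⟨fun hp => isPlot_iff_forall_plotAt.2 fun t => ?_, fun hp t => ?_⟩
  · obtain ⟨c, hc, u, hu, hl⟩ := hp t
    exact ((h c hc).plotAt u hu).of_liftsAt hl
  · obtain ⟨c, hc, u, hu, hut⟩ := exists_ext_eq hF (p t)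
    exact ⟨c, hc, u, hu, (h c hc).liftsAt_of_isPlot u hu _ p t hp hut.symm⟩

/-- Two atlases generate the same diffeology if and only if their union is compatible. -/
theorem chartDiffeology_eq_iff (hF : IsHaefligerAtlas F) (hF' : IsHaefligerAtlas F') :
    chartDiffeology F = chartDiffeology F' ↔ HaefligerCompatible (F ∪ F') := by
  refine ⟨fun h => ?_, fun h => ?_⟩
  -- The charts of both atlases are local subductions for one and the same diffeology.
  · let _ := chartDiffeology F
    refine haefligerCompatible_of_isLocalSubductionOn fun c hc => ?_
    rcases hc with hc | hc
    · exact hF.isLocalSubductionOn hc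
    · have := hF'.isLocalSubductionOn hc
      rwa [← h] at this
  · have hU : IsHaefligerAtlas (F ∪ F') := ⟨h, by
      rw [Set.biUnion_union, hF.covers, Set.univ_union]⟩
    let _ := chartDiffeology (F ∪ F')
    exact (chartDiffeology_eq (fun c hc => hU.isLocalSubductionOn (Or.inl hc)) hF.covers).trans
      (chartDiffeology_eq (fun c hc => hU.isLocalSubductionOn (Or.inr hc)) hF'.covers).symm

end Atlas

/-! ### Linearization of the isotropy action -/

namespace UniformizingChart

variable {Q : Type*} [TopologicalSpace Q] (c : UniformizingChart Q)

/-- The isotropy group of a point. -/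
def isotropy (u : EuclideanSpace ℝ (Fin c.dim)) : Subgroup c.group where
  carrier := {g | c.extPerm g u = u}
  mul_mem' {g g'} hg hg' := by
    simp only [Set.mem_ofPred_eq] at hg hg' ⊢
    rw [extPerm_mul, hg', hg]
  one_mem' := by simp only [Set.mem_ofPred_eq, extPerm_one, id]
  inv_mem' {g} hg := by
    simp only [Set.mem_ofPred_eq] at hg ⊢
    conv_lhs => rw [← hg]
    exact extPerm_inv_apply g u

variable {c} {u : EuclideanSpace ℝ (Fin c.dim)}

/-- The isotropy representation. -/
noncomputable def isotropyRep (hu : u ∈ c.ball) :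
    c.isotropy u →* (EuclideanSpace ℝ (Fin c.dim) ≃ₗ[ℝ] EuclideanSpace ℝ (Fin c.dim)) :=
  (LinearMap.GeneralLinearGroup.generalLinearEquiv ℝ _).toMonoidHom.comp
    -- A monoid homomorphism from a group lands in the units, so only the chain rule at the fixed
    -- point `u` is needed.
    (MonoidHom.toHomUnits
      { toFun := fun g => (fderiv ℝ (c.extPerm g.1) u : _ →ₗ[ℝ] _)
        map_one' := by
          rw [Subgroup.coe_one, fderiv_extPerm_one]
          rfl
        map_mul' := fun g g' => by
          rw [Subgroup.coe_mul, fderiv_extPerm_mul _ _ hu, show c.extPerm g'.1 u = u from g'.2]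
          rfl })

/-- Points near `u` that are identified by the uniformizing map are identified by an element of
the isotropy group. -/
theorem eventually_mem_isotropy (hu : u ∈ c.ball) :
    ∀ᶠ z : EuclideanSpace ℝ (Fin c.dim) × EuclideanSpace ℝ (Fin c.dim) in nhds u ×ˢ nhds u,
      ∀ g : c.group, c.extPerm g z.1 = z.2 → g ∈ c.isotropy u := by
  have := c.finite_group
  refine Filter.eventually_all.2 fun g => ?_
  by_cases hg : g ∈ c.isotropy u
  · exact Filter.Eventually.of_forall fun _ _ => hg
  · have h1 : Filter.Tendsto (fun z : EuclideanSpace ℝ (Fin c.dim) ×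
        EuclideanSpace ℝ (Fin c.dim) => c.extPerm g z.1) (nhds u ×ˢ nhds u)
        (nhds (c.extPerm g u)) :=
      (contDiffAt_extPerm g hu).continuousAt.tendsto.comp Filter.tendsto_fst
    filter_upwards [(h1.prodMk_nhds Filter.tendsto_snd).eventually
      ((isOpen_ne_fun continuous_fst continuous_snd).eventually_mem hg)] with z hz h
    exact (hz h).elim

/-- Near each point of its domain, a uniformizing chart is modelled on the quotient by a finite
linear group. -/
theorem exists_linearization (hu : u ∈ c.ball) :
    ∃ (Γ : Subgroup (EuclideanSpace ℝ (Fin c.dim) ≃ₗ[ℝ] EuclideanSpace ℝ (Fin c.dim)))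
      (φ : OpenPartialHomeomorph (EuclideanSpace ℝ (Fin c.dim)) (EuclideanSpace ℝ (Fin c.dim))),
      Finite Γ ∧ ContDiffOn ℝ ∞ φ φ.source ∧ ContDiffOn ℝ ∞ φ.symm φ.target ∧
      u ∈ φ.source ∧ φ.source ⊆ c.ball ∧
      ∀ v ∈ φ.source, ∀ w ∈ φ.source, c.ext v = c.ext w ↔
        (Quotient.mk _ (φ v) : MulAction.orbitRel.Quotient Γ (EuclideanSpace ℝ (Fin c.dim))) =
          Quotient.mk _ (φ w) := by
  have := c.finite_group
  have := Fintype.ofFinite (c.isotropy u)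
  let ρ := isotropyRep hu
  let φ : EuclideanSpace ℝ (Fin c.dim) → EuclideanSpace ℝ (Fin c.dim) :=
    -- Bochner's averaging, without normalization: reindexing the sum gives equivariance, and each
    -- summand has derivative the identity at `u`.
    fun x => ∑ g : c.isotropy u, ρ g⁻¹ (c.extPerm g.1 x - u)
  have hsm : ∀ x ∈ c.ball, ContDiffAt ℝ ∞ φ x := fun x hx => ContDiffAt.sum fun g _ =>
    (ρ g⁻¹).toContinuousLinearEquiv.contDiff.contDiffAt.comp x
      ((contDiffAt_extPerm g.1 hx).sub contDiffAt_const)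
  have hequiv : ∀ (g : c.isotropy u) x, φ (c.extPerm g.1 x) = ρ g (φ x) := fun g x => by
    simp only [φ, map_sum]
    refine Fintype.sum_equiv (Equiv.mulRight g) _ _ fun k => ?_
    rw [← extPerm_mul, ← LinearEquiv.mul_apply, ← map_mul, Equiv.coe_mulRight, mul_inv_rev,
      mul_inv_cancel_left, Subgroup.coe_mul]
  have hder : fderiv ℝ φ u = (Fintype.card (c.isotropy u) : ℝ) • ContinuousLinearMap.id ℝ _ := by
    have h1 : ∀ g : c.isotropy u, HasFDerivAt (fun x => ρ g⁻¹ (c.extPerm g.1 x - u))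
        (ContinuousLinearMap.id ℝ (EuclideanSpace ℝ (Fin c.dim))) u := fun g => by
      have h2 := (ρ g⁻¹).toContinuousLinearEquiv.hasFDerivAt.comp u
        ((((contDiffAt_extPerm g.1 hu).differentiableAt (by norm_num)).hasFDerivAt).sub_const u)
      refine h2.congr_fderiv (ContinuousLinearMap.ext fun v => ?_)
      change ρ g⁻¹ (ρ g v) = v
      rw [← LinearEquiv.mul_apply, ← map_mul, inv_mul_cancel, map_one, LinearEquiv.coe_one, id]
    refine (HasFDerivAt.fun_sum fun g _ => h1 g).fderiv.trans ?_
    rw [Finset.sum_const, Finset.card_univ]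
    exact (Nat.cast_smul_eq_nsmul ℝ _ _).symm
  have hcard : (Fintype.card (c.isotropy u) : ℝ) ≠ 0 := Nat.cast_ne_zero.2 Fintype.card_ne_zero
  have hbij : Function.Bijective (fderiv ℝ φ u) := by
    rw [hder]
    exact (LinearEquiv.smulOfNeZero ℝ (EuclideanSpace ℝ (Fin c.dim)) _ hcard).bijective
  have hsm' : ∀ᶠ x in nhds u, ContDiffAt ℝ ∞ φ x :=
    (Filter.eventually_mem_set.2 (ball_mem_nhds hu)).mono hsm
  -- Two nested domains: `φ` is injective on the source of `e₀`, and the smaller source of `e` is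
  -- chosen so that its isotropy translates stay in that of `e₀`.
  obtain ⟨e₀, he₀, hu₀, hsrc₀, -, -⟩ :=
    exists_openPartialHomeomorph_of_bijective_fderiv hsm' hbij (ball_mem_nhds hu)
  obtain ⟨W, hW, hsep⟩ := Filter.eventually_prod_self_iff
    (r := fun v w => ∀ g : c.group, c.extPerm g v = w → g ∈ c.isotropy u)
    |>.1 (eventually_mem_isotropy hu)
  have hstab : ∀ᶠ x in nhds u, ∀ g : c.isotropy u, c.extPerm g.1 x ∈ e₀.source :=
    Filter.eventually_all.2 fun g => (contDiffAt_extPerm g.1 hu).continuousAt.eventually_mem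
      (by rw [show c.extPerm g.1 u = u from g.2]; exact e₀.open_source.mem_nhds hu₀)
  obtain ⟨e, he, hue, hsrc, hse, hse'⟩ := exists_openPartialHomeomorph_of_bijective_fderiv hsm' hbij
    (Filter.inter_mem (e₀.open_source.mem_nhds hu₀) (Filter.inter_mem hW hstab))
  refine ⟨ρ.range, e, (Set.finite_range ρ).to_subtype, hse, hse', hue, fun x hx => hsrc₀ (hsrc hx).1,
    fun v hv w hw => ?_⟩
  have hvb := hsrc₀ (hsrc hv).1
  have hwb := hsrc₀ (hsrc hw).1
  rw [ext_eq_ext_iff hvb hwb, he]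
  constructor
  · rintro ⟨g, hg⟩
    have hgs := hsep v (hsrc hv).2.1 w (hsrc hw).2.1 g hg
    have h' : φ w ∈ MulAction.orbit ρ.range (φ v) :=
      ⟨⟨ρ ⟨g, hgs⟩, ⟨g, hgs⟩, rfl⟩, by rw [← hg]; exact (hequiv ⟨g, hgs⟩ v).symm⟩
    exact (Quotient.sound h').symm
  · intro h
    have h' : φ w ∈ MulAction.orbit ρ.range (φ v) := Quotient.exact h.symm
    obtain ⟨γ, hγ⟩ := h'
    obtain ⟨g, hg⟩ := γ.2
    have hg' : φ (c.extPerm g.1 v) = φ w := (hequiv g v).trans ((DFunLike.congr_fun hg (φ v)).trans hγ)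
    -- By equivariance `g v` and `w` have the same image under `φ`, and both lie where `φ` is
    -- injective.
    refine ⟨g.1, e₀.injOn ((hsrc hv).2.2 g) (hsrc hw).1 ?_⟩
    rwa [he₀]

end UniformizingChart

/-- An atlas makes the space a diffeological orbifold. -/
theorem IsHaefligerAtlas.isDiffeologicalOrbifold {Q : Type*} [TopologicalSpace Q]
    {F : Set (UniformizingChart Q)} (hF : IsHaefligerAtlas F) :
    @IsDiffeologicalOrbifold Q (chartDiffeology F) := by
  let _ := chartDiffeology F
  intro x
  obtain ⟨c, hc, u, hu, rfl⟩ := exists_ext_eq hF.covers x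
  obtain ⟨Γ, φ, hΓ, hφ, hφ', huφ, hsrc, hfib⟩ := UniformizingChart.exists_linearization hu
  exact ⟨c.dim, Γ, hΓ, ((hF.isLocalSubductionOn hc).mono φ.open_source hsrc).isLocallyDiffeomorphicAt
    ((isLocalSubductionOn_quotientMk Γ).comp_openPartialHomeomorph φ hφ hφ' (Set.subset_univ _))
    hfib huφ⟩

/-! ### Charts of a diffeological orbifold -/

/-- A finite group of linear automorphisms preserves a Euclidean norm. -/
theorem exists_norm_map_smul_eq {n : ℕ}
    (Γ : Subgroup (EuclideanSpace ℝ (Fin n) ≃ₗ[ℝ] EuclideanSpace ℝ (Fin n))) [Finite Γ] :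
    ∃ L : EuclideanSpace ℝ (Fin n) ≃L[ℝ] EuclideanSpace ℝ (Fin n),
      ∀ (γ : Γ) (x : EuclideanSpace ℝ (Fin n)), ‖L (γ • x)‖ = ‖L x‖ := by
  have := Fintype.ofFinite Γ
  -- The map `x ↦ (γ x)_γ` into an `ℓ²` sum encodes the averaged inner product; `L` is `T` followed
  -- by an isometry of its `n`-dimensional range with `ℝⁿ`.
  let T : EuclideanSpace ℝ (Fin n) →ₗ[ℝ] PiLp 2 (fun _ : Γ => EuclideanSpace ℝ (Fin n)) :=
    (WithLp.linearEquiv 2 ℝ _).symm.toLinearMap ∘ₗ LinearMap.pi fun γ : Γ => γ.1.toLinearMap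
  have hT : Function.Injective T := fun x y hxy => congrArg (fun z => z 1) hxy
  have hnorm : ∀ x, ‖T x‖ ^ 2 = ∑ γ : Γ, ‖γ • x‖ ^ 2 := fun x => PiLp.norm_sq_eq_of_L2 _ _
  let T' := LinearEquiv.ofInjective T hT
  have hrank : Module.finrank ℝ (LinearMap.range T) = n := by
    rw [← T'.finrank_eq, finrank_euclideanSpace_fin]
  let I := ((stdOrthonormalBasis ℝ (LinearMap.range T)).reindex (finCongr hrank)).repr
  refine ⟨(T'.trans I.toLinearEquiv).toContinuousLinearEquiv, fun γ x => ?_⟩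
  have h1 : ∀ y, ‖(T'.trans I.toLinearEquiv).toContinuousLinearEquiv y‖ = ‖T y‖ :=
    fun y => I.norm_map (T' y)
  rw [h1, h1, ← sq_eq_sq₀ (norm_nonneg _) (norm_nonneg _), hnorm, hnorm]
  exact Fintype.sum_equiv (Equiv.mulRight γ) _ _ fun k => by
    rw [Equiv.coe_mulRight, mul_smul]

theorem PlotAt.continuousAt {X : Type*} [d : DiffeologicalSpace X] {n : ℕ}
    {p : EuclideanSpace ℝ (Fin n) → X} {t : EuclideanSpace ℝ (Fin n)} (h : PlotAt p t) :
    @ContinuousAt _ _ _ d.dTopology p t := by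
  let _ := d.dTopology
  obtain ⟨k, P, _, hP, f, rfl, hf⟩ := h
  have h1 : ContinuousAt (P ∘ f) t :=
    ContinuousAt.comp hP.continuous.continuousAt hf.self_of_nhds.1.continuousAt
  exact h1.congr (hf.mono fun _ hs => hs.2)

/-- The image of an open set under a local subduction is open. -/
theorem IsLocalSubductionOn.isOpen_image {X : Type*} [d : DiffeologicalSpace X] {n : ℕ}
    {α : EuclideanSpace ℝ (Fin n) → X} {V : Set (EuclideanSpace ℝ (Fin n))}
    (hα : IsLocalSubductionOn α V) : @IsOpen _ d.dTopology (α '' V) := by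
  refine isOpen_iff_preimages_plots.2 fun m p hp => isOpen_iff_eventually.2 ?_
  rintro t ⟨v, hv, hvt⟩
  exact (hα.liftsAt_of_isPlot v hv m p t hp hvt.symm).eventually (P := (· ∈ α '' V))
    (Filter.mem_of_superset (hα.isOpen.mem_nhds hv) fun x hx => ⟨x, hx, rfl⟩)

/-- A local subduction on a ball whose fibres are the orbits of a finite group of
diffeomorphisms is a uniformizing chart. -/
theorem IsLocalSubductionOn.exists_uniformizingChart {Q : Type*} [d : DiffeologicalSpace Q]
    {n : ℕ} {α : EuclideanSpace ℝ (Fin n) → Q} {a : EuclideanSpace ℝ (Fin n)} {r : ℝ} (hr : 0 < r)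
    (hα : IsLocalSubductionOn α (Metric.ball a r)) (G : Subgroup (Equiv.Perm (Metric.ball a r)))
    (hG : Finite G)
    (hsm : ∀ g ∈ G, ∃ f : EuclideanSpace ℝ (Fin n) → EuclideanSpace ℝ (Fin n),
      ContDiffOn ℝ ∞ f (Metric.ball a r) ∧ ∀ u : Metric.ball a r, (g u : Metric.ball a r) = f u)
    (hfib : ∀ u v : Metric.ball a r, α u = α v ↔ ∃ g ∈ G, g u = v) :
    ∃ c : @UniformizingChart Q d.dTopology,
      IsLocalSubductionOn (@UniformizingChart.ext Q d.dTopology c)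
          (@UniformizingChart.ball Q d.dTopology c) ∧
        α a ∈ Set.range (@UniformizingChart.proj Q d.dTopology c) := by
  let _ := d.dTopology
  let b : MulAction.orbitRel.Quotient G (Metric.ball a r) → Q :=
    Quotient.lift (fun u : Metric.ball a r => α u) fun u v huv => by
      obtain ⟨g, hg⟩ := huv
      exact ((hfib v u).2 ⟨g, g.2, hg⟩).symm
  have hcont' : Continuous fun u : Metric.ball a r => α u := continuous_iff_continuousAt.2 fun u =>
    ContinuousAt.comp (g := α) (hα.plotAt u u.2).continuousAt continuous_subtype_val.continuousAt
  have hcont : Continuous b := hcont'.quotient_lift _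
  have hinj : Function.Injective b := by
    rintro ⟨u⟩ ⟨v⟩ huv
    obtain ⟨g, hg, hgu⟩ := (hfib v u).1 (Eq.symm huv)
    exact Quotient.sound ⟨⟨g, hg⟩, hgu⟩
  -- The image of `U` under `b` is the image under `α` of an open subset of the ball, and local
  -- subductions have D-open images.
  have hopen : IsOpenMap b := fun U hU => by
    have hW : IsOpen (Subtype.val '' ((Quotient.mk _ :
        Metric.ball a r → MulAction.orbitRel.Quotient G (Metric.ball a r)) ⁻¹' U)) :=
      Metric.isOpen_ball.isOpenMap_subtype_val _ (hU.preimage continuous_quotient_mk')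
    have h1 : b '' U = α '' (Subtype.val '' ((Quotient.mk _ :
        Metric.ball a r → MulAction.orbitRel.Quotient G (Metric.ball a r)) ⁻¹' U)) := by
      ext x
      constructor
      · rintro ⟨⟨u⟩, hu, rfl⟩
        exact ⟨u, ⟨u, hu, rfl⟩, rfl⟩
      · rintro ⟨_, ⟨u, hu, rfl⟩, rfl⟩
        exact ⟨_, hu, rfl⟩
    rw [h1]
    refine (hα.mono hW ?_).isOpen_image
    rintro _ ⟨u, -, rfl⟩
    exact u.2
  let c : UniformizingChart Q :=
    { dim := n
      center := a
      radius := r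
      radius_pos := hr
      group := G
      finite_group := hG
      smooth_group := hsm
      proj := fun u => α u
      induces_homeomorph :=
        ⟨b, .of_continuous_injective_isOpenMap hcont hinj hopen, fun _ => rfl⟩ }
  exact ⟨c, hα.congr fun u hu => (c.ext_of_mem hu).symm, ⟨⟨a, Metric.mem_ball_self hr⟩, rfl⟩⟩

/-- Every point of a diffeological orbifold lies in the image of a uniformizing chart that is a
local subduction. -/
theorem IsDiffeologicalOrbifold.exists_uniformizingChart {Q : Type*} [d : DiffeologicalSpace Q]
    (hQ : IsDiffeologicalOrbifold Q) (x : Q) :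
    ∃ c : @UniformizingChart Q d.dTopology,
      IsLocalSubductionOn (@UniformizingChart.ext Q d.dTopology c)
          (@UniformizingChart.ball Q d.dTopology c) ∧
        x ∈ Set.range (@UniformizingChart.proj Q d.dTopology c) := by
  obtain ⟨n, Γ, hΓ, hx⟩ := hQ x
  obtain ⟨α, V, hα, ⟨v₀, hv₀, rfl⟩, hfib⟩ :=
    hx.exists_isLocalSubductionOn (isLocalSubductionOn_quotientMk Γ) Quotient.mk_surjective
  obtain ⟨L, hL⟩ := exists_norm_map_smul_eq Γ
  let e := (L.toHomeomorph.toOpenPartialHomeomorph.restrOpen V hα.isOpen).symm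
  have hes : e.source = L.symm ⁻¹' V := by
    ext y
    simp only [e, OpenPartialHomeomorph.symm_source]
    constructor
    · intro hy
      have := (L.toHomeomorph.toOpenPartialHomeomorph.restrOpen V hα.isOpen).map_target hy
      rw [OpenPartialHomeomorph.restrOpen_source] at this
      exact this.2
    · intro hy
      have h1 : L.symm y ∈ (L.toHomeomorph.toOpenPartialHomeomorph.restrOpen V hα.isOpen).source := by
        rw [OpenPartialHomeomorph.restrOpen_source]
        exact ⟨trivial, hy⟩
      have := (L.toHomeomorph.toOpenPartialHomeomorph.restrOpen V hα.isOpen).map_source h1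
      rwa [show (L.toHomeomorph.toOpenPartialHomeomorph.restrOpen V hα.isOpen) (L.symm y) = y from
        L.apply_symm_apply y] at this
  have het : e.target ⊆ V := fun y hy => by
    simp only [e, OpenPartialHomeomorph.symm_target,
      OpenPartialHomeomorph.restrOpen_source] at hy
    exact hy.2
  have hα' : IsLocalSubductionOn (α ∘ L.symm) (L.symm ⁻¹' V) := hes ▸
    hα.comp_openPartialHomeomorph e L.symm.contDiff.contDiffOn L.contDiff.contDiffOn het
  let ρ : Γ → EuclideanSpace ℝ (Fin n) → EuclideanSpace ℝ (Fin n) :=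
    fun γ y => L (γ • L.symm y)
  have hρc : ∀ γ, ContDiff ℝ ∞ (ρ γ) := fun γ =>
    L.contDiff.comp (γ.1.toContinuousLinearEquiv.contDiff.comp L.symm.contDiff)
  have hsep : ∀ᶠ z : EuclideanSpace ℝ (Fin n) × EuclideanSpace ℝ (Fin n) in
      nhds (L v₀) ×ˢ nhds (L v₀), ∀ γ : Γ, ρ γ z.1 = z.2 → γ • v₀ = v₀ := by
    refine Filter.eventually_all.2 fun γ => ?_
    by_cases hγ : γ • v₀ = v₀
    · exact Filter.Eventually.of_forall fun _ _ => hγ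
    · have hne : ρ γ (L v₀) ≠ L v₀ := fun h => hγ (by simpa [ρ] using h)
      rw [← nhds_prod_eq]
      filter_upwards [(isOpen_ne_fun ((hρc γ).continuous.comp continuous_fst)
        continuous_snd).eventually_mem (x := (L v₀, L v₀)) hne] with z hz h
      exact (hz h).elim
  obtain ⟨W, hW, hsep⟩ := Filter.eventually_prod_self_iff
    (r := fun v w => ∀ γ : Γ, ρ γ v = w → γ • v₀ = v₀) |>.1 hsep
  obtain ⟨r, hr, hrW⟩ := Metric.mem_nhds_iff.1 (Filter.inter_mem hW
    (hα'.isOpen.mem_nhds (x := L v₀) (by simpa using hv₀)))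
  -- The stabilizer acts in the coordinates `L` by isometries that fix the centre `L v₀`.
  have hball : ∀ γ : Γ, γ • v₀ = v₀ → ∀ y ∈ Metric.ball (L v₀) r, ρ γ y ∈ Metric.ball (L v₀) r := by
    intro γ hγ y hy
    rw [mem_ball_iff_norm] at hy ⊢
    have h1 : ρ γ y - L v₀ = L (γ • (L.symm y - v₀)) := by
      rw [smul_sub, hγ, map_sub]
    rwa [h1, hL, map_sub, L.apply_symm_apply]
  have hmul : ∀ γ γ' y, ρ γ (ρ γ' y) = ρ (γ * γ') y := fun γ γ' y => by
    simp only [ρ, L.symm_apply_apply, mul_smul]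
  have hone : ∀ y, ρ 1 y = y := fun y => by simp only [ρ, one_smul, L.apply_symm_apply]
  let G : Subgroup (Equiv.Perm (Metric.ball (L v₀) r)) :=
    { carrier := {σ | ∃ γ : Γ, γ • v₀ = v₀ ∧ ∀ y, (σ y : EuclideanSpace ℝ (Fin n)) = ρ γ y}
      mul_mem' := by
        rintro σ τ ⟨γ, hγ, hσ⟩ ⟨γ', hγ', hτ⟩
        exact ⟨γ * γ', by rw [mul_smul, hγ', hγ], fun y => by
          rw [Equiv.Perm.mul_apply, hσ, hτ, hmul]⟩
      one_mem' := ⟨1, one_smul _ _, fun y => (hone y).symm⟩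
      inv_mem' := by
        rintro σ ⟨γ, hγ, hσ⟩
        refine ⟨γ⁻¹, inv_smul_eq_iff.2 hγ.symm, fun y => ?_⟩
        have h1 := hσ (σ⁻¹ y)
        rw [show σ (σ⁻¹ y) = y from σ.apply_symm_apply y] at h1
        rw [h1, hmul, inv_mul_cancel, hone] }
  have hG : Finite G := by
    choose γ hγ using fun σ : G => σ.2
    refine Finite.of_injective γ fun σ τ h => Subtype.ext (Equiv.ext fun y => Subtype.ext ?_)
    rw [(hγ σ).2, (hγ τ).2, h]
  have hfinal := (hα'.mono Metric.isOpen_ball fun y hy => (hrW hy).2).exists_uniformizingChart hr G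
    hG (fun σ hσ => ?_) fun v w => ?_
  · simpa using hfinal
  · obtain ⟨γ, -, hγ⟩ := hσ
    exact ⟨ρ γ, (hρc γ).contDiffOn, hγ⟩
  · rw [eq_comm, Function.comp_apply, Function.comp_apply, hfib _ (hrW w.2).2 _ (hrW v.2).2]
    constructor
    · intro h
      have h' : L.symm w ∈ MulAction.orbit Γ (L.symm v.1) := Quotient.exact h
      obtain ⟨γ, hγ⟩ := h'
      have hγw : ρ γ v = w := by
        simp only [ρ]
        exact (congrArg L hγ).trans (L.apply_symm_apply _)
      -- The ball is so small that an element of `Γ` carrying one of its points to another must fix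
      -- `v₀`; it therefore preserves the ball and defines an element of `G`.
      have hγ₀ := hsep v (hrW v.2).1 w (hrW w.2).1 γ hγw
      have hγ₀' : γ⁻¹ • v₀ = v₀ := inv_smul_eq_iff.2 hγ₀.symm
      exact ⟨⟨fun y => ⟨ρ γ y, hball γ hγ₀ y y.2⟩, fun y => ⟨ρ γ⁻¹ y, hball γ⁻¹ hγ₀' y y.2⟩,
        fun y => Subtype.ext (by simp only [hmul, inv_mul_cancel, hone]),
        fun y => Subtype.ext (by simp only [hmul, mul_inv_cancel, hone])⟩,
        ⟨γ, hγ₀, fun _ => rfl⟩, Subtype.ext hγw⟩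
    · rintro ⟨σ, ⟨γ, -, hγ⟩, rfl⟩
      have h' : L.symm (σ v : EuclideanSpace ℝ (Fin n)) ∈ MulAction.orbit Γ (L.symm v.1) :=
        ⟨γ, by rw [hγ]; exact (L.symm_apply_apply _).symm⟩
      exact Quotient.sound h'

/-- Every diffeological orbifold, with its D-topology, carries an atlas that generates its
diffeology. -/
theorem IsDiffeologicalOrbifold.exists_isHaefligerAtlas {Q : Type*} [d : DiffeologicalSpace Q]
    (hQ : IsDiffeologicalOrbifold Q) : ∃ F : Set (@UniformizingChart Q d.dTopology),
      @IsHaefligerAtlas Q d.dTopology F ∧ @chartDiffeology Q d.dTopology F = d := by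
  let _ := d.dTopology
  -- Taking all such charts avoids choices: compatibility is automatic, and only covering needs the
  -- orbifold condition.
  let F : Set (UniformizingChart Q) := {c | IsLocalSubductionOn c.ext c.ball}
  have hcov : ⋃ c ∈ F, Set.range c.proj = Set.univ := Set.eq_univ_of_forall fun x => by
    obtain ⟨c, hc, hx⟩ := hQ.exists_uniformizingChart x
    exact Set.mem_biUnion hc hx
  exact ⟨F, ⟨haefligerCompatible_of_isLocalSubductionOn fun _ hc => hc, hcov⟩,
    chartDiffeology_eq (fun _ hc => hc) hcov⟩

theorem mainTheorem3 (Q : Type*) :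
    -- A Haefliger atlas makes `Q` a diffeological orbifold.
    (∀ (_ : TopologicalSpace Q) (F : Set (UniformizingChart Q)), IsHaefligerAtlas F →
      @IsDiffeologicalOrbifold Q (chartDiffeology F)) ∧
    -- Two atlases generate the same diffeology iff their union is compatible.
    (∀ (_ : TopologicalSpace Q) (F F' : Set (UniformizingChart Q)),
      IsHaefligerAtlas F → IsHaefligerAtlas F' →
        (chartDiffeology F = chartDiffeology F' ↔ HaefligerCompatible (F ∪ F'))) ∧
    -- Every diffeological orbifold, with its D-topology, carries an atlas generating it.
    (∀ d : DiffeologicalSpace Q, IsDiffeologicalOrbifold Q →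
      ∃ F : Set (@UniformizingChart Q d.dTopology),
        @IsHaefligerAtlas Q d.dTopology F ∧ @chartDiffeology Q d.dTopology F = d) :=
  ⟨fun _ _ hF => hF.isDiffeologicalOrbifold, fun _ _ _ hF hF' => chartDiffeology_eq_iff hF hF',
    fun _ hQ => hQ.exists_isHaefligerAtlas⟩
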